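/- Let $(R,\mathfrak m)$ be a one-dimensional analytically irreducible local domain with quotient field $Q(R)$, that is, a one-dimensional Noetherian local domain whose integral closure $\overline R$ in $Q(R)$ is a discrete valuation ring and a finite $R$-module. Assume that $R$ is Gorenstein. For a nonzero fractional ideal $I$ put $I^{-1}=\{f\in Q(R) : fI\subseteq R\}$, and let $C=\{f\in Q(R): f\overline R\subseteq R\}$ be the conductor of $R$. An ideal of $R$ is called a trace ideal if it is of the form $\operatorname{tr}(M)=\sum_{\varphi\in\operatorname{Hom}_R(M,R)}\varphi(M)$ for some finitely generated $R$-module $M$. Let $\mathcal T_R$ be the set of nonzero trace ideals of $R$ (so $R\in\mathcal T_R$), and for an ideal $I$ of $R$ let $\operatorname{subtr}(I)$ be the largest trace ideal contained in $I$, which is the sum of all trace ideals contained in $I$. For $I,J\in\mathcal T_R$ put $I*J=(I^{-1}J^{-1})^{-1}$, and note that this expression also makes sense for $J=C$. Then for all $I,J\in\mathcal T_R$: (a) $I*J\in\mathcal T_R$. (b) $I*J=J*I$, $R*I=I*I=I$ and $I*C=C$. (c) $I*J=\operatorname{subtr}(I\cap J)\subseteq I\cap J$; that is, $I*J$ is the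 largest trace ideal contained in $I\cap J$. In particular, $I\cap J$ is a trace ideal if and only if $I\cap J=I*J$. -/

import Mathlib

open scoped nonZeroDivisors

universe u v

/-- A Noetherian local ring is Gorenstein if it has finite injective dimension as a module
over itself. -/
def IsGorensteinLocal (R : Type u) [CommRing R] [IsLocalRing R] [IsNoetherianRing R] : Prop :=
  ∃ n : ℕ, CategoryTheory.HasInjectiveDimensionLE (ModuleCat.of R R) n

/-- A one-dimensional analytically irreducible local domain: a one-dimensional Noetherian local
domain `R` with quotient field `K` such that the integral closure of `R` in `K` is a discrete
valuation ring and a finite `R`-module. -/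
structure IsOneDimAnalyticallyIrreducible (R : Type u) (K : Type v) [CommRing R] [IsDomain R]
    [IsLocalRing R] [IsNoetherianRing R] [Field K] [Algebra R K] [IsFractionRing R K] :
    Prop where
  dim_eq_one : ringKrullDim R = 1
  integralClosure_dvr : IsDiscreteValuationRing (integralClosure R K)
  integralClosure_finite : Module.Finite R (integralClosure R K)

/-- The trace of a module `M`: the sum of the ideals `φ(M)`, where `φ` runs over `Hom_R(M, R)`. -/
def moduleTrace (R : Type u) [CommRing R] (M : Type v) [AddCommGroup M] [Module R M] : Ideal R :=
  ⨆ φ : M →ₗ[R] R, LinearMap.range φ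

/-- An ideal is a trace ideal if it is the trace of a finitely generated module. -/
def IsTraceIdeal {R : Type u} [CommRing R] (I : Ideal R) : Prop :=
  ∃ (M : Type u) (_ : AddCommGroup M) (_ : Module R M),
    Module.Finite R M ∧ I = moduleTrace R M

section Fractional

variable (R : Type u) (K : Type v) [CommRing R] [IsDomain R] [Field K] [Algebra R K]
  [IsFractionRing R K]

/-- The set of nonzero fractional ideals that are trace ideals of `R`. -/
def traceIdeals : Set (FractionalIdeal R⁰ K) :=
  {I | I ≠ 0 ∧ ∃ a : Ideal R, IsTraceIdeal a ∧ (a : FractionalIdeal R⁰ K) = I}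

theorem one_div_integralClosure_le_one :
    (1 : Submodule R K) / Subalgebra.toSubmodule (integralClosure R K) ≤ 1 := by
  intro x hx
  have h := Submodule.mem_div_iff_forall_mul_mem.mp hx 1 (one_mem (integralClosure R K))
  rwa [mul_one] at h

/-- The conductor `C = R : R̄ = {x ∈ K | x R̄ ⊆ R}`, where `R̄` is the integral closure of `R`
in `K`. -/
noncomputable def conductorIdeal : FractionalIdeal R⁰ K :=
  ⟨(1 : Submodule R K) / Subalgebra.toSubmodule (integralClosure R K),
    FractionalIdeal.isFractional_of_le_one _ (one_div_integralClosure_le_one R K)⟩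

variable {R K}

/-- The product `I * J = (I⁻¹ J⁻¹)⁻¹`. For a nonzero fractional ideal `I`, the fractional ideal
`I⁻¹` is `{f ∈ K | f I ⊆ R}`. -/
noncomputable def starMul (I J : FractionalIdeal R⁰ K) : FractionalIdeal R⁰ K :=
  (I⁻¹ * J⁻¹)⁻¹

/-- The sum of all trace ideals of `R` (including the zero ideal) contained in `I`. -/
noncomputable def subtr (I : FractionalIdeal R⁰ K) : FractionalIdeal R⁰ K :=
  ((sSup {a : Ideal R | IsTraceIdeal a ∧ (a : FractionalIdeal R⁰ K) ≤ I} : Ideal R) :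
    FractionalIdeal R⁰ K)

end Fractional

/-! A nonzero ideal `I` is a trace ideal iff `I⁻¹ * I ≤ I` (`mem_traceIdeals_iff`). Then `I⁻¹` is an
overring of `R`, and conversely the inverse of a fractional overring is a trace ideal
(`inv_mem_traceIdeals`). Over a Gorenstein `R` ideals are reflexive, so `I ↦ I⁻¹` is an
order-reversing bijection between nonzero trace ideals and fractional overrings. The product of two
overrings is the least overring containing both, hence its inverse is the largest trace ideal inside
both ideals. The conductor corresponds to the largest overring, the integral closure.

Reflexivity (`inv_inv_eq_of_isGorensteinLocal`) comes from finite injective dimension: descending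
induction gives `Ext²(T, R) = 0` for `T` of finite length, hence `Ext¹(J, R) = 0` for nonzero ideals
`J`, and so enough linear forms to separate `z ∉ I` from `I`. -/

/-! ### Vanishing of Ext over a one-dimensional Gorenstein domain. -/

section Ext

open CategoryTheory CategoryTheory.Abelian

variable {R : Type u} [CommRing R]

/-- The vanishing of `Ext^i(M, R)`. -/
def ExtVanishes (R : Type u) [CommRing R] (M : Type u) [AddCommGroup M] [Module R M]
    (i : ℕ) : Prop :=
  Subsingleton (Ext.{u} (ModuleCat.of R M) (ModuleCat.of R R) i)

namespace ExtVanishes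

variable {A B C : Type u} [AddCommGroup A] [AddCommGroup B] [AddCommGroup C]
  [Module R A] [Module R B] [Module R C] {f : A →ₗ[R] B} {g : B →ₗ[R] C} {i : ℕ}

theorem of_eq_zero
    (h : ∀ e : Ext.{u} (ModuleCat.of R A) (ModuleCat.of R R) i, e = 0) : ExtVanishes R A i :=
  ⟨fun a b => (h a).trans (h b).symm⟩

theorem eq_zero (h : ExtVanishes R A i)
    (e : Ext.{u} (ModuleCat.of R A) (ModuleCat.of R R) i) : e = 0 :=
  h.elim _ _

theorem of_projective [Module.Projective R A] : ExtVanishes R A (i + 1) :=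
  of_eq_zero fun e => by
    have : Projective (ModuleCat.of R A) := (IsProjective.iff_projective A).mp ‹_›
    exact e.eq_zero_of_projective

theorem of_subsingleton [Subsingleton A] : ExtVanishes R A i := by
  cases i with
  | zero =>
    refine of_eq_zero fun e => ?_
    obtain ⟨φ, rfl⟩ := Ext.homEquiv₀.symm.surjective e
    have : φ = 0 := by
      ext x
      rw [Subsingleton.elim (α := A) x 0]
      simp
    simp [this]
  | succ i => exact of_projective

theorem middle (hf : Function.Injective f) (hfg : Function.Exact f g)
    (hg : Function.Surjective g) (hA : ExtVanishes R A i) (hC : ExtVanishes R C i) :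
    ExtVanishes R B i := by
  have hS := ModuleCat.shortComplex_shortExact
    (ModuleCat.shortComplexOfCompEqZero f g hfg.linearMap_comp_eq_zero) hfg hf hg
  refine of_eq_zero fun e => ?_
  obtain ⟨e', rfl⟩ := Ext.contravariant_sequence_exact₂ hS _ e (hA.eq_zero _)
  rw [hC.eq_zero e', Ext.comp_zero]

theorem left (hf : Function.Injective f) (hfg : Function.Exact f g)
    (hg : Function.Surjective g) (hB : ExtVanishes R B i) (hC : ExtVanishes R C (i + 1)) :
    ExtVanishes R A i := by
  have hS := ModuleCat.shortComplex_shortExact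
    (ModuleCat.shortComplexOfCompEqZero f g hfg.linearMap_comp_eq_zero) hfg hf hg
  refine of_eq_zero fun e => ?_
  obtain ⟨e', rfl⟩ := Ext.contravariant_sequence_exact₁ hS _ e (add_comm 1 i) (hC.eq_zero _)
  rw [hB.eq_zero e', Ext.comp_zero]

theorem right (hf : Function.Injective f) (hfg : Function.Exact f g)
    (hg : Function.Surjective g) (hA : ExtVanishes R A i) (hB : ExtVanishes R B (i + 1)) :
    ExtVanishes R C (i + 1) := by
  have hS := ModuleCat.shortComplex_shortExact
    (ModuleCat.shortComplexOfCompEqZero f g hfg.linearMap_comp_eq_zero) hfg hf hg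
  refine of_eq_zero fun e => ?_
  obtain ⟨e', rfl⟩ := Ext.contravariant_sequence_exact₃ hS _ e (hB.eq_zero _) (add_comm 1 i)
  rw [hA.eq_zero e', Ext.comp_zero]

/-- If `Ext¹(A, R) = 0`, linear maps from `A` to `R ⧸ (x)` lift to `R` for `x` regular. -/
theorem exists_lift [IsDomain R] (h : ExtVanishes R A 1) {x : R} (hx : x ≠ 0)
    (φ : A →ₗ[R] R ⧸ Ideal.span {x}) :
    ∃ ψ : A →ₗ[R] R, ∀ a, Ideal.Quotient.mk (Ideal.span {x}) (ψ a) = φ a := by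
  have hex : Function.Exact (LinearMap.lsmul R R x) (Ideal.span {x}).mkQ := by
    intro r
    rw [Submodule.mkQ_apply, Submodule.Quotient.mk_eq_zero, Ideal.mem_span_singleton']
    simp [mul_comm]
  have hS := ModuleCat.shortComplex_shortExact
    (ModuleCat.shortComplexOfCompEqZero _ _ hex.linearMap_comp_eq_zero) hex
    (fun a b hab => mul_left_cancel₀ hx hab) (Submodule.mkQ_surjective _)
  obtain ⟨e, he⟩ := Ext.covariant_sequence_exact₃ (ModuleCat.of R A) hS
    (Ext.mk₀ (ModuleCat.ofHom φ)) (zero_add 1) (h.eq_zero _)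
  obtain ⟨ψ, rfl⟩ := (Ext.mk₀_bijective _ _).surjective e
  rw [Ext.mk₀_comp_mk₀] at he
  have he := (Ext.mk₀_bijective _ _).injective he
  exact ⟨ψ.hom, fun a => LinearMap.congr_fun (congrArg ModuleCat.Hom.hom he) a⟩

end ExtVanishes

theorem exists_mem_maximalIdeal_ne_zero [IsLocalRing R] (hdim : ringKrullDim R = 1) :
    ∃ x ∈ IsLocalRing.maximalIdeal R, x ≠ 0 := by
  by_contra! h
  have hF : IsField R := IsLocalRing.isField_iff_maximalIdeal_eq.mpr
    ((Submodule.eq_bot_iff _).mpr h)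
  rw [ringKrullDim_eq_zero_of_isField hF] at hdim
  exact zero_ne_one hdim

/-- Multiplication by `x` gives a free resolution of length one. -/
theorem ExtVanishes.quotient_span_singleton [IsDomain R] {x : R} (hx : x ≠ 0) {i : ℕ} :
    ExtVanishes R (R ⧸ Ideal.span {x}) (i + 2) := by
  have hex : Function.Exact (LinearMap.lsmul R R x) (Ideal.span {x}).mkQ := by
    intro r
    rw [Submodule.mkQ_apply, Submodule.Quotient.mk_eq_zero, Ideal.mem_span_singleton']
    simp [mul_comm]
  exact .right (fun a b hab => mul_left_cancel₀ hx hab) hex (Submodule.mkQ_surjective _)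
    .of_projective .of_projective

theorem ExtVanishes.of_isFiniteLength {i : ℕ}
    (h : ∀ (S : Type u) [AddCommGroup S] [Module R S] [IsSimpleModule R S], ExtVanishes R S i)
    {T : Type u} [AddCommGroup T] [Module R T] (hT : IsFiniteLength R T) :
    ExtVanishes R T i := by
  induction hT with
  | of_subsingleton => exact .of_subsingleton
  | @of_simple_quotient M _ _ N _ _ ih =>
    exact .middle N.injective_subtype (LinearMap.exact_subtype_mkQ N) N.mkQ_surjective ih (h _)

variable [IsDomain R] [IsLocalRing R] [IsNoetherianRing R]

/-- In a one-dimensional Noetherian local domain, `R ⧸ (x)` has a nonzero element annihilated by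
the maximal ideal. -/
theorem exists_ne_zero_maximalIdeal_smul_eq_zero [Ring.KrullDimLE 1 R] {x : R} (hx : x ≠ 0)
    (hxm : x ∈ IsLocalRing.maximalIdeal R) :
    ∃ y : R ⧸ Ideal.span {x}, y ≠ 0 ∧ ∀ r ∈ IsLocalRing.maximalIdeal R, r • y = 0 := by
  have : Nontrivial (R ⧸ Ideal.span {x}) := Ideal.Quotient.nontrivial_iff.mpr fun h =>
    (IsLocalRing.mem_maximalIdeal x).mp hxm (Ideal.span_singleton_eq_top.mp h)
  -- An associated prime contains `x ≠ 0`, so it is maximal in dimension one.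
  obtain ⟨P, hP⟩ := associatedPrimes.nonempty R (R ⧸ Ideal.span {x})
  obtain ⟨hPp, y, rfl⟩ := isAssociatedPrime_iff.mp hP
  have hxP : x ∈ (⊥ : Submodule R (R ⧸ Ideal.span {x})).colon {y} := by
    rw [Submodule.mem_colon_singleton, Submodule.mem_bot]
    obtain ⟨r, rfl⟩ := Ideal.Quotient.mk_surjective y
    exact (Submodule.Quotient.mk_eq_zero _).mpr (Ideal.mul_mem_right r _
      (Ideal.mem_span_singleton_self x))
  have hmax := hPp.isMaximal_of_ne_bot fun h => hx (by rwa [h] at hxP)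
  refine ⟨y, ?_, fun r hr => ?_⟩
  · rintro rfl
    exact hPp.ne_top (by simp)
  · rw [← IsLocalRing.eq_maximalIdeal hmax, Submodule.mem_colon_singleton] at hr
    simpa using hr

theorem exists_injective_of_isSimpleModule [Ring.KrullDimLE 1 R] {x : R} (hx : x ≠ 0)
    (hxm : x ∈ IsLocalRing.maximalIdeal R) (S : Type u) [AddCommGroup S] [Module R S]
    [IsSimpleModule R S] : ∃ f : S →ₗ[R] R ⧸ Ideal.span {x}, Function.Injective f := by
  obtain ⟨y, hy, hmy⟩ := exists_ne_zero_maximalIdeal_smul_eq_zero hx hxm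
  obtain ⟨m, hm, ⟨e⟩⟩ := isSimpleModule_iff_quot_maximal.mp ‹IsSimpleModule R S›
  let g : (R ⧸ m) →ₗ[R] R ⧸ Ideal.span {x} :=
    m.liftQ (LinearMap.toSpanSingleton R _ y) fun r hr => by
      rw [IsLocalRing.eq_maximalIdeal hm] at hr
      simpa using hmy r hr
  refine ⟨g ∘ₗ e, LinearMap.injective_of_ne_zero fun h => hy ?_⟩
  have h1 : g (e (e.symm (Submodule.Quotient.mk 1))) = 0 := LinearMap.congr_fun h _
  rw [LinearEquiv.apply_symm_apply, Submodule.liftQ_apply] at h1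
  simpa using h1

/-- Over a one-dimensional Gorenstein local domain, `Ext²(T, R) = 0` for `T` of finite length. -/
theorem extVanishes_two_of_isFiniteLength (hdim : ringKrullDim R = 1)
    (hG : IsGorensteinLocal R) {T : Type u} [AddCommGroup T] [Module R T]
    (hT : IsFiniteLength R T) : ExtVanishes R T 2 := by
  have : Ring.KrullDimLE 1 R := Ring.krullDimLE_iff.mpr hdim.le
  obtain ⟨x, hxm, hx⟩ := exists_mem_maximalIdeal_ne_zero hdim
  obtain ⟨n, hn⟩ := hG
  -- Descending induction on the degree, started above the injective dimension. A simple `S` embeds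
  -- in `R ⧸ (x)`, so `Ext^(k+2)(S, R)` is squeezed between `Ext^(k+2)(R ⧸ (x), R) = 0` and
  -- `Ext^(k+3)` of the cokernel, which again has finite length.
  have key : ∀ k, (∀ (T : Type u) [AddCommGroup T] [Module R T], IsFiniteLength R T →
      ExtVanishes R T (k + 2)) → ∀ (T : Type u) [AddCommGroup T] [Module R T],
      IsFiniteLength R T → ExtVanishes R T 2 := by
    intro k
    induction k with
    | zero => exact fun h => h
    | succ k ih =>
      refine fun h => ih fun T _ _ hT => .of_isFiniteLength (fun S _ _ _ => ?_) hT
      obtain ⟨f, hf⟩ := exists_injective_of_isSimpleModule hx hxm S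
      have hfl := isFiniteLength_quotient_span_singleton R (mem_nonZeroDivisors_of_ne_zero hx)
      obtain ⟨_, _⟩ := isFiniteLength_iff_isNoetherian_isArtinian.mp hfl
      exact .left hf (LinearMap.exact_map_mkQ_range f) (Submodule.mkQ_surjective _)
        (.quotient_span_singleton hx)
        (h _ (isFiniteLength_iff_isNoetherian_isArtinian.mpr ⟨inferInstance, inferInstance⟩))
  exact key n (fun T _ _ _ => hn.subsingleton _ _ (n + 2) (by lia) _) T hT

/-- Shift degrees along `0 → J → R → R ⧸ J → 0`; the quotient has finite length. -/
theorem extVanishes_one_ideal (hdim : ringKrullDim R = 1) (hG : IsGorensteinLocal R)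
    {J : Ideal R} (hJ : J ≠ ⊥) : ExtVanishes R J 1 := by
  have : Ring.KrullDimLE 1 R := Ring.krullDimLE_iff.mpr hdim.le
  obtain ⟨x, hxJ, hx⟩ := Submodule.exists_mem_ne_zero_of_ne_bot hJ
  have hfl := isFiniteLength_quotient_span_singleton R (mem_nonZeroDivisors_of_ne_zero hx)
  obtain ⟨_, _⟩ := isFiniteLength_iff_isNoetherian_isArtinian.mp hfl
  have hle : Ideal.span {x} ≤ J := (Ideal.span_singleton_le_iff_mem J).mpr hxJ
  have hs : Function.Surjective (Submodule.factor hle) := Submodule.factor_surjective hle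
  refine .left J.injective_subtype (LinearMap.exact_subtype_mkQ J) J.mkQ_surjective
    .of_projective (extVanishes_two_of_isFiniteLength hdim hG ?_)
  exact isFiniteLength_iff_isNoetherian_isArtinian.mpr
    ⟨isNoetherian_of_surjective (Submodule.factor hle) (LinearMap.range_eq_top.mpr hs),
      isArtinian_of_surjective _ _ hs⟩

/-- For `z ∉ I` there is a linear form on an ideal containing `I` and `z` that maps `I` into `(x)`,
but not `z`. -/
theorem exists_linearMap_separating (hdim : ringKrullDim R = 1) (hG : IsGorensteinLocal R)
    (I : Ideal R) {z : R} (hz : z ∉ I) :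
    ∃ x : R, x ≠ 0 ∧ ∃ ψ : (I ⊔ Ideal.span {z} : Ideal R) →ₗ[R] R,
      (∀ w, w.1 ∈ I → x ∣ ψ w) ∧ ∃ w, w.1 = z ∧ ¬ x ∣ ψ w := by
  have : Ring.KrullDimLE 1 R := Ring.krullDimLE_iff.mpr hdim.le
  obtain ⟨x, hxm, hx⟩ := exists_mem_maximalIdeal_ne_zero hdim
  obtain ⟨y, hy, hmy⟩ := exists_ne_zero_maximalIdeal_smul_eq_zero hx hxm
  have hzJ : z ∈ I ⊔ Ideal.span {z} :=
    Ideal.mem_sup_right (Ideal.mem_span_singleton_self z)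
  have hJ : I ⊔ Ideal.span {z} ≠ ⊥ := fun h => hz (by
    rw [h, Ideal.mem_bot] at hzJ
    simp [hzJ])
  -- The form to be lifted is `a + r z ↦ r y`, with `y` in the socle of `R ⧸ (x)`. It is well
  -- defined because `r z ∈ I` with `z ∉ I` forces `r` to be a nonunit, and nonunits kill `y`.
  let s : (I × R) →ₗ[R] (I ⊔ Ideal.span {z} : Ideal R) :=
    ((I.subtype.comp (LinearMap.fst R I R)) +
      ((LinearMap.toSpanSingleton R R z).comp (LinearMap.snd R I R))).codRestrict _ fun p =>
        add_mem (Ideal.mem_sup_left p.1.2) (Ideal.mul_mem_left _ _ hzJ)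
  have hs : Function.Surjective s := by
    rintro ⟨w, hw⟩
    obtain ⟨a, ha, b, hb, rfl⟩ := Submodule.mem_sup.mp hw
    obtain ⟨r, rfl⟩ := Ideal.mem_span_singleton'.mp hb
    exact ⟨(⟨a, ha⟩, r), Subtype.ext (by simp [s])⟩
  let t : (I × R) →ₗ[R] R ⧸ Ideal.span {x} :=
    (LinearMap.toSpanSingleton R _ y).comp (LinearMap.snd R I R)
  have hker : LinearMap.ker s ≤ LinearMap.ker t := by
    rintro ⟨a, r⟩ h
    have h' : (a : R) + r * z = 0 := by simpa [s] using congrArg Subtype.val h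
    have hr : r * z ∈ I := by
      rw [eq_neg_of_add_eq_zero_right h']
      exact neg_mem a.2
    have : r ∈ IsLocalRing.maximalIdeal R := fun hu => hz ((Ideal.unit_mul_mem_iff_mem I hu).mp hr)
    simpa [t] using hmy r this
  let φ := ((LinearMap.ker s).liftQ t hker).comp
    (s.quotKerEquivOfSurjective hs).symm.toLinearMap
  have hφ : ∀ p, φ (s p) = t p := fun p => by
    have : (s.quotKerEquivOfSurjective hs).symm (s p) = Submodule.Quotient.mk p := by
      rw [LinearEquiv.symm_apply_eq]
      rfl
    simp [φ, this]
  obtain ⟨ψ, hψ⟩ := (extVanishes_one_ideal hdim hG hJ).exists_lift hx φ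
  refine ⟨x, hx, ψ, fun w hw => ?_, s (0, 1), by simp [s], fun h => ?_⟩
  · rw [← Ideal.mem_span_singleton, ← Ideal.Quotient.eq_zero_iff_mem, hψ]
    have : w = s (⟨w, hw⟩, 0) := Subtype.ext (by simp [s])
    rw [this, hφ]
    simp [t]
  · rw [← Ideal.mem_span_singleton, ← Ideal.Quotient.eq_zero_iff_mem, hψ, hφ] at h
    exact hy (by simpa [t] using h)

end Ext

/-! ### Trace ideals and their inverses in the quotient field. -/

section TraceIdeals

variable {R : Type u} {K : Type v} [CommRing R] [IsDomain R] [Field K] [Algebra R K]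
  [IsFractionRing R K]

open FractionalIdeal

section

variable {R : Type u} {K : Type v} [CommRing R] [Field K] [Algebra R K]

theorem FractionalIdeal.ne_zero_of_one_le {I : FractionalIdeal R⁰ K} (h : 1 ≤ I) : I ≠ 0 := by
  rintro rfl
  exact one_ne_zero (le_antisymm h (FractionalIdeal.zero_le 1))

end

theorem FractionalIdeal.le_inv_iff_mul_le_one {I J : FractionalIdeal R⁰ K} (hJ : J ≠ 0) :
    I ≤ J⁻¹ ↔ I * J ≤ 1 := by
  rw [FractionalIdeal.inv_eq, le_div_iff_mul_le hJ]

theorem FractionalIdeal.inv_mul_le_one (I : FractionalIdeal R⁰ K) : I⁻¹ * I ≤ 1 := by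
  rcases eq_or_ne I 0 with rfl | hI
  · simp
  · exact (le_inv_iff_mul_le_one hI).mp le_rfl

theorem FractionalIdeal.inv_ne_zero_of_ne_zero {I : FractionalIdeal R⁰ K} (hI : I ≠ 0) :
    I⁻¹ ≠ 0 := fun h => by
  have := bot_lt_mul_inv hI
  simp [h] at this

theorem FractionalIdeal.le_inv_inv {I : FractionalIdeal R⁰ K} (hI : I ≠ 0) : I ≤ I⁻¹⁻¹ := by
  rw [le_inv_iff_mul_le_one (inv_ne_zero_of_ne_zero hI), mul_comm]
  exact inv_mul_le_one I

section

variable {R : Type u} {K : Type v} [CommRing R] [Field K] [Algebra R K] [IsFractionRing R K]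

/-- A linear form on an ideal is multiplication by an element of the quotient field. -/
theorem exists_eq_mul_of_linearMap {J : Ideal R} (hJ : J ≠ ⊥) (φ : J →ₗ[R] R) :
    ∃ q : K, ∀ w : J, algebraMap R K (φ w) = q * algebraMap R K w := by
  obtain ⟨z, hz, hz0⟩ := Submodule.exists_mem_ne_zero_of_ne_bot hJ
  have hz' : algebraMap R K z ≠ 0 := by simpa using hz0
  refine ⟨algebraMap R K (φ ⟨z, hz⟩) / algebraMap R K z, fun w => ?_⟩
  have h : z * φ w = w * φ ⟨z, hz⟩ := by
    rw [← smul_eq_mul, ← smul_eq_mul, ← map_smul, ← map_smul]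
    congr 1
    exact Subtype.ext (mul_comm _ _)
  have h' := congrArg (algebraMap R K) h
  simp only [map_mul] at h'
  field_simp
  linear_combination h'

theorem exists_linearMap_eq_mul {M : Type*} [AddCommGroup M] [Module R M] (φ : M →ₗ[R] R) (q : K)
    (h : ∀ m, ∃ r, algebraMap R K r = q * algebraMap R K (φ m)) :
    ∃ ψ : M →ₗ[R] R, ∀ m, algebraMap R K (ψ m) = q * algebraMap R K (φ m) := by
  let L : M →ₗ[R] K := (LinearMap.mulLeft R q).comp ((Algebra.linearMap R K).comp φ)
  let e := LinearEquiv.ofInjective (Algebra.linearMap R K) (IsFractionRing.injective R K)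
  let L' := L.codRestrict (LinearMap.range (Algebra.linearMap R K)) h
  refine ⟨e.symm.toLinearMap.comp L', fun m => ?_⟩
  exact congrArg Subtype.val (e.apply_symm_apply (L' m))

end

/-- If `q ∈ a⁻¹` and `φ` is a form on `M`, then `q φ` is again a form on `M`, so its values lie in
the trace. -/
theorem IsTraceIdeal.inv_mul_le {a : Ideal R} (ha : IsTraceIdeal a) :
    (a : FractionalIdeal R⁰ K)⁻¹ * a ≤ a := by
  rcases eq_or_ne a ⊥ with rfl | h0
  · simp
  obtain ⟨M, _, _, -, ha⟩ := ha
  refine FractionalIdeal.mul_le.mpr fun q hq u hu => ?_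
  have hq := (mem_inv_iff (coeIdeal_ne_zero.mpr h0)).mp hq
  obtain ⟨u, hua, rfl⟩ := (mem_coeIdeal R⁰).mp hu
  clear hu
  rw [ha] at hua
  induction hua using Submodule.iSup_induction' with
  | mem φ u hφ =>
    obtain ⟨m, rfl⟩ := hφ
    obtain ⟨ψ, hψ⟩ := exists_linearMap_eq_mul φ q fun m =>
      (mem_one_iff R⁰).mp (hq _ (mem_coeIdeal_of_mem R⁰
        (ha ▸ Submodule.mem_iSup_of_mem φ ⟨m, rfl⟩)))
    rw [← hψ]
    exact mem_coeIdeal_of_mem R⁰ (ha ▸ Submodule.mem_iSup_of_mem ψ ⟨m, rfl⟩)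
  | zero => simp
  | add u w hu hw hu' hw' =>
    rw [map_add, mul_add]
    exact add_mem (S := Submodule R K) hu' hw'

/-- Such an ideal is its own trace: every form on `a` is multiplication by an element of `a⁻¹`. -/
theorem isTraceIdeal_of_inv_mul_le [IsNoetherianRing R] {a : Ideal R} (h0 : a ≠ ⊥)
    (h : (a : FractionalIdeal R⁰ K)⁻¹ * a ≤ a) : IsTraceIdeal a := by
  refine ⟨a, inferInstance, inferInstance, inferInstance, le_antisymm ?_ ?_⟩
  · exact le_iSup_of_le a.subtype (by simp)
  · refine iSup_le fun φ => ?_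
    rintro _ ⟨w, rfl⟩
    obtain ⟨q, hq⟩ := exists_eq_mul_of_linearMap (K := K) h0 φ
    have hqa : q ∈ (a : FractionalIdeal R⁰ K)⁻¹ := by
      rw [mem_inv_iff (coeIdeal_ne_zero.mpr h0)]
      intro y hy
      obtain ⟨u, hu, rfl⟩ := (mem_coeIdeal R⁰).mp hy
      exact (mem_one_iff R⁰).mpr ⟨_, hq ⟨u, hu⟩⟩
    have := h (FractionalIdeal.mul_mem_mul hqa (mem_coeIdeal_of_mem R⁰ w.2))
    rw [← hq] at this
    obtain ⟨r, hr, hr'⟩ := (mem_coeIdeal R⁰).mp this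
    rwa [← IsFractionRing.injective R K hr']

theorem mem_traceIdeals_iff [IsNoetherianRing R] {I : FractionalIdeal R⁰ K} :
    I ∈ traceIdeals R K ↔ I ≠ 0 ∧ I ≤ 1 ∧ I⁻¹ * I ≤ I := by
  constructor
  · rintro ⟨h0, a, ha, rfl⟩
    exact ⟨h0, coeIdeal_le_one, ha.inv_mul_le⟩
  · rintro ⟨h0, h1, h⟩
    obtain ⟨a, rfl⟩ := le_one_iff_exists_coeIdeal.mp h1
    exact ⟨h0, a, isTraceIdeal_of_inv_mul_le (coeIdeal_ne_zero.mp h0) h, rfl⟩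

theorem one_le_inv_of_mem_traceIdeals [IsNoetherianRing R] {I : FractionalIdeal R⁰ K}
    (hI : I ∈ traceIdeals R K) : 1 ≤ I⁻¹ := by
  obtain ⟨h0, h1, -⟩ := mem_traceIdeals_iff.mp hI
  rwa [le_inv_iff_mul_le_one h0, one_mul]

theorem inv_mul_inv_of_mem_traceIdeals [IsNoetherianRing R] {I : FractionalIdeal R⁰ K}
    (hI : I ∈ traceIdeals R K) : I⁻¹ * I⁻¹ = I⁻¹ := by
  obtain ⟨h0, -, h⟩ := mem_traceIdeals_iff.mp hI
  refine le_antisymm ?_ ?_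
  · rw [le_inv_iff_mul_le_one h0, mul_assoc]
    exact (mul_le_mul_right h _).trans (inv_mul_le_one I)
  · simpa using mul_le_mul_right (one_le_inv_of_mem_traceIdeals hI) I⁻¹

/-- The inverse of an overring of `R` that is a fractional ideal is a trace ideal. -/
theorem inv_mem_traceIdeals [IsNoetherianRing R] {S : FractionalIdeal R⁰ K} (h1 : 1 ≤ S)
    (hS : S * S = S) : S⁻¹ ∈ traceIdeals R K := by
  have h0 : S ≠ 0 := ne_zero_of_one_le h1
  refine mem_traceIdeals_iff.mpr ⟨inv_ne_zero_of_ne_zero h0, ?_, ?_⟩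
  · simpa using (mul_le_mul_right h1 S⁻¹).trans (inv_mul_le_one S)
  -- `S⁻¹` is an `S`-module, so `S⁻¹⁻¹ * S⁻¹ * S ≤ S⁻¹⁻¹ * S⁻¹ ≤ 1`.
  · have hle : S⁻¹ * S ≤ S⁻¹ := by
      rw [le_inv_iff_mul_le_one h0, mul_assoc, hS]
      exact inv_mul_le_one S
    rw [le_inv_iff_mul_le_one h0, mul_assoc]
    exact (mul_le_mul_right hle _).trans (inv_mul_le_one _)

end TraceIdeals

/-! ### Reflexivity, the conductor and the star product. -/

section

open FractionalIdeal

section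

variable {R : Type u} {K : Type v} [CommRing R] [IsDomain R] [Field K] [Algebra R K]
  [IsFractionRing R K]

theorem starMul_comm (I J : FractionalIdeal R⁰ K) : starMul I J = starMul J I := by
  rw [starMul, mul_comm, starMul]

end

section

variable {R : Type u} {K : Type v} [CommRing R] [Field K] [Algebra R K] [IsFractionRing R K]

theorem eq_subtr_of_isGreatest {I L : FractionalIdeal R⁰ K}
    (h : IsGreatest {L | L ∈ traceIdeals R K ∧ L ≤ I} L) : L = subtr I := by
  obtain ⟨⟨⟨-, a, ha, rfl⟩, haI⟩, hmax⟩ := h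
  refine congrArg _ (le_antisymm (le_sSup ⟨ha, haI⟩) (sSup_le fun b hb => ?_))
  -- `subtr` also sums over the zero ideal, which `traceIdeals` excludes.
  rcases eq_or_ne b ⊥ with rfl | hb0
  · exact bot_le
  · exact (coeIdeal_le_coeIdeal K).mp
      (hmax ⟨⟨coeIdeal_ne_zero.mpr hb0, b, hb.1, rfl⟩, hb.2⟩)

end

variable {R : Type u} {K : Type v} [CommRing R] [IsDomain R] [IsNoetherianRing R] [Field K]
  [Algebra R K] [IsFractionRing R K]

/-- Nonzero ideals of a one-dimensional Gorenstein local domain are reflexive. -/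
theorem inv_inv_eq_of_isGorensteinLocal [IsLocalRing R] (hdim : ringKrullDim R = 1)
    (hG : IsGorensteinLocal R) {I : FractionalIdeal R⁰ K} (h0 : I ≠ 0) (h1 : I ≤ 1) :
    I⁻¹⁻¹ = I := by
  refine le_antisymm (fun z hz => ?_) (le_inv_inv h0)
  obtain ⟨a, rfl⟩ := le_one_iff_exists_coeIdeal.mp h1
  have hz' := (mem_inv_iff (inv_ne_zero_of_ne_zero h0)).mp hz
  have h1' : (1 : FractionalIdeal R⁰ K) ≤ (a : FractionalIdeal R⁰ K)⁻¹ := by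
    rwa [le_inv_iff_mul_le_one h0, one_mul]
  obtain ⟨z, rfl⟩ := (mem_one_iff R⁰).mp
    (by simpa using hz' 1 (h1' (one_mem_one R⁰)) : z ∈ (1 : FractionalIdeal R⁰ K))
  refine mem_coeIdeal_of_mem R⁰ ?_
  by_contra hza
  -- Write `ψ` as multiplication by `q`. Since `x` divides `ψ` on `a`, `q / x ∈ a⁻¹`; then `z ∈
  -- a⁻¹⁻¹` gives `x ∣ ψ z`, a contradiction.
  obtain ⟨x, hx, ψ, hψ, w, hwz, hw⟩ := exists_linearMap_separating hdim hG a hza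
  obtain ⟨q, hq⟩ := exists_eq_mul_of_linearMap (K := K) (fun h => by
    have hz0 : z ∈ a ⊔ Ideal.span {z} :=
      Ideal.mem_sup_right (Ideal.mem_span_singleton_self z)
    rw [h, Ideal.mem_bot] at hz0
    exact hza (hz0 ▸ zero_mem a)) ψ
  have hx' : algebraMap R K x ≠ 0 := by simpa using hx
  have hmem : q / algebraMap R K x ∈ (a : FractionalIdeal R⁰ K)⁻¹ := by
    rw [mem_inv_iff h0]
    intro y hy
    obtain ⟨u, hu, rfl⟩ := (mem_coeIdeal R⁰).mp hy
    obtain ⟨r, hr⟩ := hψ ⟨u, Ideal.mem_sup_left hu⟩ hu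
    refine (mem_one_iff R⁰).mpr ⟨r, ?_⟩
    have := hq ⟨u, Ideal.mem_sup_left hu⟩
    rw [hr, map_mul] at this
    field_simp
    linear_combination this
  obtain ⟨r, hr⟩ := (mem_one_iff R⁰).mp (hz' _ hmem)
  refine hw ⟨r, IsFractionRing.injective R K ?_⟩
  rw [map_mul, hr, hq, hwz]
  field_simp

/-- For an ideal `I` with `I⁻¹ I ⊆ I`, the elements of `I⁻¹` are integral. -/
theorem isIntegral_of_mem_inv {I : FractionalIdeal R⁰ K} (hI : I ∈ traceIdeals R K) {x : K}
    (hx : x ∈ I⁻¹) : IsIntegral R x := by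
  obtain ⟨h0, -, h⟩ := mem_traceIdeals_iff.mp hI
  -- Determinant trick: `x` stabilises the nonzero finitely generated module `I`.
  refine isIntegral_of_smul_mem_submodule (I : Submodule R K) (fun h => h0 ?_)
    ((isNoetherian_submodule.mp (FractionalIdeal.isNoetherian I)) _ le_rfl) x
    fun n hn => h (mul_mem_mul hx hn)
  exact coeToSubmodule_eq_bot.mp h

variable (R K) in
/-- If the integral closure is finite, the conductor is the inverse of a fractional overring
containing all integral elements. -/
theorem exists_conductorIdeal_eq_inv (hfin : Module.Finite R (integralClosure R K)) :
    ∃ S : FractionalIdeal R⁰ K, 1 ≤ S ∧ S * S = S ∧ (∀ x, IsIntegral R x → x ∈ S) ∧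
      conductorIdeal R K = S⁻¹ := by
  let N := Subalgebra.toSubmodule (integralClosure R K)
  let S : FractionalIdeal R⁰ K := ⟨N, isFractional_of_fg (Module.Finite.iff_fg.mp hfin)⟩
  have h1 : 1 ≤ S := fun x hx => by
    obtain ⟨r, rfl⟩ := (mem_one_iff R⁰).mp hx
    exact (integralClosure R K).algebraMap_mem r
  have h0 : S ≠ 0 := ne_zero_of_one_le h1
  refine ⟨S, h1, le_antisymm (FractionalIdeal.mul_le.mpr fun i hi j hj =>
    (integralClosure R K).mul_mem hi hj) ?_, fun x hx => hx, ?_⟩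
  · simpa using mul_le_mul_right h1 S
  · refine coeToSubmodule_injective ?_
    change _ = ((1 / S : FractionalIdeal R⁰ K) : Submodule R K)
    rw [coe_div h0, coe_one]
    rfl

variable {I J : FractionalIdeal R⁰ K}

theorem one_le_inv_mul_inv_of_mem_traceIdeals (hI : I ∈ traceIdeals R K)
    (hJ : J ∈ traceIdeals R K) : 1 ≤ I⁻¹ * J⁻¹ := by
  simpa using mul_le_mul' (one_le_inv_of_mem_traceIdeals hI) (one_le_inv_of_mem_traceIdeals hJ)

theorem starMul_mem_traceIdeals (hI : I ∈ traceIdeals R K) (hJ : J ∈ traceIdeals R K) :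
    starMul I J ∈ traceIdeals R K := by
  refine inv_mem_traceIdeals ?_ ?_
  · exact one_le_inv_mul_inv_of_mem_traceIdeals hI hJ
  · rw [mul_mul_mul_comm, inv_mul_inv_of_mem_traceIdeals hI, inv_mul_inv_of_mem_traceIdeals hJ]

variable [IsLocalRing R]

theorem inv_inv_of_mem_traceIdeals (hdim : ringKrullDim R = 1)
    (hG : IsGorensteinLocal R) (hI : I ∈ traceIdeals R K) : I⁻¹⁻¹ = I := by
  obtain ⟨h0, h1, -⟩ := mem_traceIdeals_iff.mp hI
  exact inv_inv_eq_of_isGorensteinLocal hdim hG h0 h1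

theorem starMul_le_left (hdim : ringKrullDim R = 1) (hG : IsGorensteinLocal R)
    (hI : I ∈ traceIdeals R K) (hJ : J ∈ traceIdeals R K) :
    starMul I J ≤ I := by
  rw [starMul]
  conv_rhs => rw [← inv_inv_of_mem_traceIdeals hdim hG hI]
  refine inv_anti_mono (inv_ne_zero_of_ne_zero hI.1)
    (ne_zero_of_one_le (one_le_inv_mul_inv_of_mem_traceIdeals hI hJ)) ?_
  simpa using mul_le_mul_right (one_le_inv_of_mem_traceIdeals hJ) I⁻¹

/-- The ring `L⁻¹` contains `I⁻¹` and `J⁻¹`, hence their product; now dualise. -/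
theorem le_starMul (hdim : ringKrullDim R = 1) (hG : IsGorensteinLocal R)
    {L : FractionalIdeal R⁰ K} (hI : I ∈ traceIdeals R K)
    (hJ : J ∈ traceIdeals R K) (hL : L ∈ traceIdeals R K) (hLI : L ≤ I) (hLJ : L ≤ J) :
    L ≤ starMul I J := by
  rw [← inv_inv_of_mem_traceIdeals hdim hG hL]
  refine inv_anti_mono (ne_zero_of_one_le (one_le_inv_mul_inv_of_mem_traceIdeals hI hJ))
    (inv_ne_zero_of_ne_zero hL.1) ?_
  rw [← inv_mul_inv_of_mem_traceIdeals hL]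
  exact mul_le_mul' (inv_anti_mono hL.1 hI.1 hLI) (inv_anti_mono hL.1 hJ.1 hLJ)

theorem isGreatest_starMul (hdim : ringKrullDim R = 1) (hG : IsGorensteinLocal R)
    (hI : I ∈ traceIdeals R K) (hJ : J ∈ traceIdeals R K) :
    IsGreatest {L | L ∈ traceIdeals R K ∧ L ≤ I ⊓ J} (starMul I J) := by
  refine ⟨⟨starMul_mem_traceIdeals hI hJ, le_inf (starMul_le_left hdim hG hI hJ) ?_⟩,
    fun L hL => le_starMul hdim hG hI hJ hL.1 (hL.2.trans inf_le_left) (hL.2.trans inf_le_right)⟩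
  rw [starMul_comm]
  exact starMul_le_left hdim hG hJ hI

/-- The conductor is the least nonzero trace ideal: `I⁻¹` consists of integral elements, so
dualising puts the conductor inside `I`. -/
theorem starMul_conductorIdeal (hdim : ringKrullDim R = 1) (hG : IsGorensteinLocal R)
    (hfin : Module.Finite R (integralClosure R K))
    (hI : I ∈ traceIdeals R K) : starMul I (conductorIdeal R K) = conductorIdeal R K := by
  obtain ⟨S, h1, hS, hint, hC⟩ := exists_conductorIdeal_eq_inv R K hfin
  have hCmem : conductorIdeal R K ∈ traceIdeals R K := hC ▸ inv_mem_traceIdeals h1 hS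
  have h0 : S ≠ 0 := ne_zero_of_one_le h1
  refine le_antisymm ?_ (le_starMul hdim hG hI hCmem hCmem ?_ le_rfl)
  · rw [starMul_comm]
    exact starMul_le_left hdim hG hCmem hI
  · rw [hC, ← inv_inv_of_mem_traceIdeals hdim hG hI]
    exact inv_anti_mono (inv_ne_zero_of_ne_zero hI.1) h0
      fun x hx => hint x (isIntegral_of_mem_inv hI hx)

end

theorem mainTheorem8 (R : Type u) (K : Type v) [CommRing R] [IsDomain R] [IsLocalRing R]
    [IsNoetherianRing R] [Field K] [Algebra R K] [IsFractionRing R K]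
    (hR : IsOneDimAnalyticallyIrreducible R K) (hG : IsGorensteinLocal R)
    (I J : FractionalIdeal R⁰ K) (hI : I ∈ traceIdeals R K) (hJ : J ∈ traceIdeals R K) :
    starMul I J ∈ traceIdeals R K ∧
    (starMul I J = starMul J I ∧ starMul 1 I = I ∧ starMul I I = I ∧
      starMul I (conductorIdeal R K) = conductorIdeal R K) ∧
    (starMul I J = subtr (I ⊓ J) ∧
      IsGreatest {L | L ∈ traceIdeals R K ∧ L ≤ I ⊓ J} (starMul I J) ∧
      starMul I J ≤ I ⊓ J ∧
      (I ⊓ J ∈ traceIdeals R K ↔ I ⊓ J = starMul I J)) := by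
  have hII := inv_inv_of_mem_traceIdeals hR.dim_eq_one hG hI
  have hgr := isGreatest_starMul hR.dim_eq_one hG hI hJ
  refine ⟨hgr.1.1, ⟨starMul_comm I J, ?_, ?_,
    starMul_conductorIdeal hR.dim_eq_one hG hR.integralClosure_finite hI⟩,
    eq_subtr_of_isGreatest hgr, hgr, hgr.1.2, fun h => le_antisymm (hgr.2 ⟨h, le_rfl⟩) hgr.1.2,
    fun h => h ▸ hgr.1.1⟩
  · rw [starMul, FractionalIdeal.inv_eq (I := 1), FractionalIdeal.div_one, one_mul, hII]
  · rw [starMul, inv_mul_inv_of_mem_traceIdeals hI, hII]
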